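/- **Theorem 1.6.** Let $\Omega\subset\mathbb R^N$ be an unbounded domain (open connected set) with non-empty boundary $\partial\Omega$. Let $u,v:\overline\Omega\to\mathbb R$ be such that $u$ is upper semicontinuous and $v$ is lower semicontinuous on $\overline\Omega$ (for instance $u,v\in C(\overline\Omega)$), the restrictions of $u$ and $v$ to $\partial\Omega$ are uniformly continuous and bounded, and $u$ and $-v$ are infinity subharmonic on $\Omega$. Here an upper semicontinuous function $w$ is infinity subharmonic on $\Omega$ if $\Delta_\infty w\ge 0$ in $\Omega$ in the viscosity sense for the normalized infinity Laplacian: whenever $x\in\Omega$, $\varphi$ is $C^2$ near $x$ and $w-\varphi$ has a local maximum at $x$, then $$\frac{\langle D^2\varphi(x)\nabla\varphi(x),\nabla\varphi(x)\rangle}{|\nabla\varphi(x)|^2}\ge 0\ \text{ if }\nabla\varphi(x)\ne0,\qquad \sup_{|e|=1}\langle D^2\varphi(x)e,e\rangle\ge 0\ \text{ if }\nabla\varphi(x)=0.$$ Let $d_{\overline\Omega}(x,y)\in[0,\infty]$ be the infimum of the lengths of the paths in $\overline\Omega$ from $x$ to $y$, and $d_{\overline\Omega}(y,\partial\Omega)=\inf_{z\in\partial\Omega}d_{\overline\Omega}(y,z)$.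 Suppose that $$\limsup_{r\to\infty}\frac{\sup\{u(y): y\in\overline\Omega,\ d_{\overline\Omega}(y,\partial\Omega)\le r\}}{r}\ \le\ 0\ \le\ \liminf_{r\to\infty}\frac{\inf\{v(y): y\in\overline\Omega,\ d_{\overline\Omega}(y,\partial\Omega)\le r\}}{r},$$ where the supremum and the infimum are taken in $[-\infty,\infty]$. Then $$u(x)-v(x)\le \sup_{\partial\Omega}(u-v)\qquad\text{for all }x\in\Omega.$$ -/

import Mathlib

open Set Filter Topology
open scoped ENNReal

noncomputable section

/-- Euclidean space `ℝ^N`. -/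
abbrev Eucl (N : ℕ) : Type := EuclideanSpace ℝ (Fin N)

/-- The second derivative of `φ` at `x` as a quadratic form: `⟨D²φ(x) e, e⟩`. -/
def hessForm {N : ℕ} (φ : Eucl N → ℝ) (x e : Eucl N) : ℝ :=
  fderiv ℝ (fderiv ℝ φ) x e e

/-- The upper (semicontinuous envelope of the) normalized infinity Laplacian of a `C²` function:
`⟨D²φ(x) ∇φ(x), ∇φ(x)⟩ / |∇φ(x)|²` where the gradient does not vanish, and
`sup_{|e| = 1} ⟨D²φ(x) e, e⟩`, the largest eigenvalue of the Hessian, where it does. -/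
def upperInfLaplacian {N : ℕ} (φ : Eucl N → ℝ) (x : Eucl N) : ℝ :=
  open Classical in
  if gradient φ x = 0 then sSup (hessForm φ x '' Metric.sphere (0 : Eucl N) 1)
  else hessForm φ x (gradient φ x) / ‖gradient φ x‖ ^ 2

/-- `u` is infinity subharmonic on the open set `Ω`, i.e. `Δ_∞ u ≥ 0` in the viscosity sense:
`u` is upper semicontinuous on `Ω`, and every `C²` function `φ` such that `u - φ` has a local
maximum at a point `x ∈ Ω` satisfies `Δ_∞ φ(x) ≥ 0`. -/
def InfSubharmonicOn {N : ℕ} (u : Eucl N → ℝ) (Ω : Set (Eucl N)) : Prop :=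
  UpperSemicontinuousOn u Ω ∧
    ∀ x ∈ Ω, ∀ φ : Eucl N → ℝ, ContDiffAt ℝ 2 φ x →
      IsLocalMax (fun y => u y - φ y) x → 0 ≤ upperInfLaplacian φ x

/-- The induced intrinsic metric `d_K(x, y)` of `K`: the infimum of the lengths of the continuous
paths from `x` to `y` inside `K` (`∞` if there is no rectifiable one). -/
def intrinsicEDist {N : ℕ} (K : Set (Eucl N)) (x y : Eucl N) : ℝ≥0∞ :=
  ⨅ (γ : Path x y) (_ : ∀ t, γ t ∈ K), eVariationOn γ Set.univ

/-- The intrinsic distance `d_K(x, S) = inf_{z ∈ S} d_K(x, z)` from a point to a set. -/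
def intrinsicInfEDist {N : ℕ} (K : Set (Eucl N)) (x : Eucl N) (S : Set (Eucl N)) : ℝ≥0∞ :=
  ⨅ z ∈ S, intrinsicEDist K x z

/-- The points `y` of the closure of `Ω` at intrinsic distance at most `r` from the boundary. -/
def boundaryLayer {N : ℕ} (Ω : Set (Eucl N)) (r : ℝ) : Set (Eucl N) :=
  {y ∈ closure Ω | intrinsicInfEDist (closure Ω) y (frontier Ω) ≤ ENNReal.ofReal r}

end

/-!
The argument is the finite-difference proof of comparison for infinity harmonic functions, with a
modification that dispenses with attained maxima on unbounded domains.

Write `w = -v`. An infinity subharmonic function enjoys comparison with cones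
(`InfSubharmonicOn.le_cone`), since a slightly bent cone is strictly infinity superharmonic
(`upperInfLaplacian_bentCone`). The segment from a point of `Ω` to a nearest boundary point lies in
`closure Ω`, so the growth condition bounds `u` and `w` by `C + σ |y - z|` for every `σ > 0` and
`z ∈ ∂Ω` (`SublinearAbove`). Hence comparison also holds on all of `Ω` with cones of positive slope
whose vertex `z` lies on `∂Ω` (`InfSubharmonicOn.le_cone_of_frontier`). It follows that `u` and `w`
are bounded above and that they exceed their boundary values near `∂Ω` by little, uniformly along
`∂Ω` (`InfSubharmonicOn.exists_boundary_modulus`).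

For small `ε` the maxima `U`, `W` of `u`, `w` over `ε`-balls satisfy the discrete inequality
`2 U(x) ≤ max U + inf U` over the `ε`-ball around `x`
(`InfSubharmonicOn.discreteInfSubharmonic_ballSup`), and `U + W` is at most
`sup_{∂Ω} (u - v)` up to a small error at distance at most `2 ε` from `∂Ω`. So everything reduces to
comparison on a graph for functions bounded above (`DiscreteInfSubharmonic.add_le`).

There, suppose that `U + W` exceeds its boundary bound `m` at a vertex `x₀`. If `U` and `W` have zero
slope at `x₀`, both are at least as large at all neighbours, and one moves one step closer to the
boundary. Otherwise let, say, `U` have slope `δ > 0` at `x₀`. Replace `U` by the minorant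
that agrees with `U` where the slope is at least `δ` and decreases with slope `δ` away from there
(`SteepMinorant`). It is again subharmonic, keeps the value at `x₀`, and increases by at least `δ`
in one step from every interior vertex. Starting where (minorant `+ W`) is within `τ` of its
supremum, the step that increases the minorant at most doubles `τ`. For `τ` small this climbs
arbitrarily high without reaching the boundary, which contradicts that `U` is bounded above.
-/

/-! ### Comparison on graphs -/

/-- Discrete infinity subharmonicity on the set `I` of interior vertices of a graph with adjacency
relation `r`: `2 U(x) ≤ max U + inf U` over the neighbours of `x`, the maximum being attained. -/
def DiscreteInfSubharmonic {α : Type*} (r : α → α → Prop) (I : Set α) (U : α → ℝ) : Prop :=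
  ∀ x ∈ I, ∃ p, r x p ∧ ∀ y, r x y → U y ≤ U p ∧ 2 * U x ≤ U p + U y

/-- A set of points below the graph of `U`. It contains the graph over the boundary vertices
`X \ I` and over the vertices of slope at least `δ`, and it is continued with slope `-δ` through the
vertices of smaller slope. The function `x ↦ sup {t | SteepMinorant r I X U δ x t}` is the
modification of `U` that solves the eikonal equation with slope `δ` where `U` is flatter than
that. -/
inductive SteepMinorant {α : Type*} (r : α → α → Prop) (I X : Set α) (U : α → ℝ) (δ : ℝ) :
    α → ℝ → Prop
  | boundary {x : α} (hX : x ∈ X) (hI : x ∉ I) : SteepMinorant r I X U δ x (U x)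
  | steep {x : α} (hI : x ∈ I) (h : ∃ p, r x p ∧ U x + δ ≤ U p) : SteepMinorant r I X U δ x (U x)
  | flat {w y : α} {t : ℝ} (hw : SteepMinorant r I X U δ w t) (hr : r w y) (hI : y ∈ I)
      (h : ¬ ∃ p, r y p ∧ U y + δ ≤ U p) : SteepMinorant r I X U δ y (t - δ)

section Discrete

variable {α : Type*} {r : α → α → Prop} {I X : Set α} {U W : α → ℝ} {δ : ℝ}

lemma SteepMinorant.le (hsymm : ∀ x y, r x y → r y x) {x : α} {t : ℝ}
    (h : SteepMinorant r I X U δ x t) : t ≤ U x := by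
  induction h with
  | boundary => exact le_rfl
  | steep => exact le_rfl
  | @flat w y t hw hr hI hflat ih =>
    by_contra! hlt
    exact hflat ⟨w, hsymm _ _ hr, by linarith⟩

lemma SteepMinorant.mem (hIX : I ⊆ X) {x : α} {t : ℝ}
    (h : SteepMinorant r I X U δ x t) : x ∈ X := by
  cases h with
  | boundary hX => exact hX
  | steep hI => exact hIX hI
  | flat _ _ hI => exact hIX hI

/-- The steep minorant is again infinity subharmonic, and its upward slope is at least `δ`. -/
lemma SteepMinorant.exists_step (hsymm : ∀ x y, r x y → r y x)
    (hIX : ∀ x ∈ I, ∀ y, r x y → y ∈ X) (hU : DiscreteInfSubharmonic r I U)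
    {x : α} {t : ℝ} (h : SteepMinorant r I X U δ x t) (hx : x ∈ I) :
    ∃ p s, r x p ∧ SteepMinorant r I X U δ p s ∧ t + δ ≤ s ∧
      ∀ y, r x y → ∃ t', SteepMinorant r I X U δ y t' ∧ 2 * t ≤ s + t' := by
  obtain ⟨p, hxp, hp⟩ := hU x hx
  have hkey : ∀ y, y ∈ X → (y ∈ I → ∃ q, r y q ∧ U y + δ ≤ U q) →
      SteepMinorant r I X U δ y (U y) := by
    intro y hyX hy
    by_cases hyI : y ∈ I
    · exact .steep hyI (hy hyI)
    · exact .boundary hyX hyI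
  have hsteep : (∃ q, r x q ∧ U x + δ ≤ U q) → ∃ p s, r x p ∧ SteepMinorant r I X U δ p s ∧
      U x + δ ≤ s ∧ ∀ y, r x y → ∃ t', SteepMinorant r I X U δ y t' ∧ 2 * U x ≤ s + t' := by
    rintro ⟨q, hxq, hq⟩
    have hqp := (hp q hxq).1
    refine ⟨p, U p, hxp, hkey p (hIX x hx p hxp) fun hpI => ?_, by linarith, fun y hxy => ?_⟩
    · -- the slope does not decrease along a step to a maximal neighbour
      obtain ⟨p', hpp', hp'⟩ := hU p hpI
      have := (hp' x (hsymm _ _ hxp)).2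
      exact ⟨p', hpp', by linarith⟩
    · by_cases hy : y ∈ I → ∃ q, r y q ∧ U y + δ ≤ U q
      · exact ⟨U y, hkey y (hIX x hx y hxy) hy, (hp y hxy).2⟩
      · push Not at hy
        exact ⟨U x - δ, .flat (.steep hx ⟨q, hxq, hq⟩) hxy hy.1
          (by rintro ⟨q, h1, h2⟩; exact absurd h2 (not_le.2 (hy.2 q h1))), by linarith⟩
  have hcases := h
  cases hcases with
  | boundary _ hI => exact absurd hx hI
  | steep _ hst => exact hsteep hst
  | @flat w _ t hw hr _ hflat =>
    refine ⟨w, t, hsymm _ _ hr, hw, by linarith, fun y hxy => ?_⟩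
    by_cases hy : y ∈ I → ∃ q, r y q ∧ U y + δ ≤ U q
    · refine ⟨U y, hkey y (hIX x hx y hxy) hy, ?_⟩
      have h1 := (hp y hxy).2
      have h2 : U p < U x + δ := by
        by_contra! h2
        exact hflat ⟨p, hxp, h2⟩
      have h3 := h.le hsymm
      linarith
    · push Not at hy
      exact ⟨t - δ - δ, .flat h hxy hy.1
        (by rintro ⟨q, h1, h2⟩; exact absurd h2 (not_le.2 (hy.2 q h1))), by linarith⟩

/-- Comparison at a vertex where `U` has positive slope. Along steps to maximal neighbours the steep
minorant of `U` grows by `δ`, whereas the distance of (minorant `+ W`) to its supremum at most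
doubles. Hence a start close enough to the supremum leads to arbitrarily large values of `U`. -/
lemma DiscreteInfSubharmonic.add_le_of_slope_pos (hsymm : ∀ x y, r x y → r y x) (hsub : I ⊆ X)
    (hIX : ∀ x ∈ I, ∀ y, r x y → y ∈ X) (hU : DiscreteInfSubharmonic r I U)
    (hW : DiscreteInfSubharmonic r I W) {A B m : ℝ} (hA : ∀ x ∈ X, U x ≤ A)
    (hB : ∀ x ∈ X, W x ≤ B) (hm : ∀ x ∈ X, x ∉ I → U x + W x ≤ m) {x p : α} (hx : x ∈ I)
    (hxp : r x p) (hlt : U x < U p) : U x + W x ≤ m := by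
  by_contra! hgt
  obtain ⟨δ, hδ⟩ : ∃ δ, δ = U p - U x := ⟨_, rfl⟩
  have hδ0 : 0 < δ := by linarith
  let S : Set ℝ := {d | ∃ y t, SteepMinorant r I X U δ y t ∧ d = t + W y}
  have hS : BddAbove S := by
    refine ⟨A + B, ?_⟩
    rintro _ ⟨y, t, h, rfl⟩
    have := h.le hsymm
    have := hA y (h.mem hsub)
    have := hB y (h.mem hsub)
    linarith
  have hxS : U x + W x ∈ S := ⟨x, U x, .steep hx ⟨p, hxp, by linarith⟩, rfl⟩
  have hle : ∀ y t, SteepMinorant r I X U δ y t → t + W y ≤ sSup S :=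
    fun y t h => le_csSup hS ⟨y, t, h, rfl⟩
  have hM : m < sSup S := hgt.trans_le (le_csSup hS hxS)
  have hclimb : ∀ n : ℕ, ∀ τ > 0, ∃ y t, SteepMinorant r I X U δ y t ∧
      sSup S - τ < t + W y ∧ m - B + n * δ ≤ t := by
    intro n
    induction n with
    | zero =>
      intro τ hτ
      have : max (sSup S - τ) m < sSup S := max_lt (by linarith) hM
      obtain ⟨_, ⟨y, t, h, rfl⟩, hlt⟩ := exists_lt_of_lt_csSup ⟨_, hxS⟩ this
      have h1 := (max_lt_iff.1 hlt).1
      have h2 := (max_lt_iff.1 hlt).2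
      have := hB y (h.mem hsub)
      exact ⟨y, t, h, h1, by push_cast; linarith⟩
    | succ n ih =>
      intro τ hτ
      obtain ⟨y, t, h, h1, h2⟩ := ih (min (τ / 2) (sSup S - m))
        (lt_min (by linarith) (by linarith))
      have h3 := min_le_left (τ / 2) (sSup S - m)
      have h4 := min_le_right (τ / 2) (sSup S - m)
      have hyI : y ∈ I := by
        by_contra hyI
        have := hm y (h.mem hsub) hyI
        have := h.le hsymm
        linarith
      obtain ⟨q, hyq, hq⟩ := hW y hyI
      obtain ⟨p', s, hyp', hs, hts, hnb⟩ := h.exists_step hsymm hIX hU hyI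
      obtain ⟨t', ht', h5⟩ := hnb q hyq
      have h6 := (hq p' hyp').2
      have h7 := hle q t' ht'
      exact ⟨p', s, hs, by linarith, by push_cast; linarith⟩
  obtain ⟨n, hn⟩ := exists_nat_gt ((A + B - m) / δ)
  rw [div_lt_iff₀ hδ0] at hn
  obtain ⟨y, t, h, -, h2⟩ := hclimb n 1 one_pos
  have := h.le hsymm
  have := hA y (h.mem hsub)
  linarith

/-- Comparison on a graph for functions that are only bounded above. The function `rank` witnesses
that the boundary `X \ I` can be reached from every interior vertex. -/
theorem DiscreteInfSubharmonic.add_le (hsymm : ∀ x y, r x y → r y x) (hsub : I ⊆ X)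
    (hIX : ∀ x ∈ I, ∀ y, r x y → y ∈ X) (hU : DiscreteInfSubharmonic r I U)
    (hW : DiscreteInfSubharmonic r I W) {A B m : ℝ} (hA : ∀ x ∈ X, U x ≤ A)
    (hB : ∀ x ∈ X, W x ≤ B) (hm : ∀ x ∈ X, x ∉ I → U x + W x ≤ m)
    (rank : α → ℕ) (hrank : ∀ x ∈ I, ∃ y, r x y ∧ rank y < rank x) :
    ∀ x ∈ X, U x + W x ≤ m := by
  intro x
  induction hn : rank x using Nat.strong_induction_on generalizing x with
  | _ n ih =>
    intro hxX
    by_cases hx : x ∈ I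
    swap
    · exact hm x hxX hx
    obtain ⟨p, hxp, hp⟩ := hU x hx
    obtain ⟨q, hxq, hq⟩ := hW x hx
    by_cases h1 : U x < U p
    · exact hU.add_le_of_slope_pos hsymm hsub hIX hW hA hB hm hx hxp h1
    by_cases h2 : W x < W q
    · have := hW.add_le_of_slope_pos (m := m) hsymm hsub hIX hU hB hA
        (fun y hy hy' => by linarith [hm y hy hy']) hx hxq h2
      linarith
    -- both slopes vanish, so `U` and `W` do not decrease from `x` to any of its neighbours
    obtain ⟨y, hxy, hy⟩ := hrank x hx
    have h3 := ih _ (hn ▸ hy) y rfl (hIX x hx y hxy)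
    have h4 := (hp y hxy).2
    have h5 := (hq y hxy).2
    linarith

end Discrete

/-! ### Comparison with cones -/

section Barrier

variable {N : ℕ}

/-- A cone with vertex `z`, slope `b` and value `a` at the vertex, bent downwards. -/
noncomputable def bentCone (z : Eucl N) (a b γ : ℝ) (y : Eucl N) : ℝ :=
  a + b * ‖y - z‖ - γ * ‖y - z‖ ^ 2

lemma contDiffAt_bentCone {z x : Eucl N} (a b γ : ℝ) (h : x ≠ z) :
    ContDiffAt ℝ 2 (bentCone z a b γ) x := by
  have hn : ContDiffAt ℝ 2 (fun y : Eucl N => ‖y - z‖) x :=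
    (contDiffAt_id.sub contDiffAt_const).norm ℝ (sub_ne_zero.2 h)
  exact (contDiffAt_const.add (contDiffAt_const.mul hn)).sub (contDiffAt_const.mul (hn.pow 2))

lemma hasFDerivAt_norm_sub {z x : Eucl N} (h : x ≠ z) :
    HasFDerivAt (fun y : Eucl N => ‖y - z‖) ((1 / ‖x - z‖) • innerSL ℝ (x - z)) x := by
  have h0 : ‖x - z‖ ≠ 0 := norm_ne_zero_iff.2 (sub_ne_zero.2 h)
  have h1 : HasFDerivAt (fun y : Eucl N => ‖y - z‖ ^ 2) _ x :=
    ((hasFDerivAt_id x).sub_const z).norm_sq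
  have h2 := h1.sqrt (by positivity)
  have h3 : (fun y : Eucl N => √(‖y - z‖ ^ 2)) = fun y => ‖y - z‖ := by
    funext y; exact Real.sqrt_sq (norm_nonneg _)
  rw [h3] at h2
  refine h2.congr_fderiv (ContinuousLinearMap.ext fun e => ?_)
  simp [Real.sqrt_sq (norm_nonneg _)]
  field_simp

lemma hasFDerivAt_bentCone {z x : Eucl N} (a b γ : ℝ) (h : x ≠ z) :
    HasFDerivAt (bentCone z a b γ) ((b / ‖x - z‖ - 2 * γ) • innerSL ℝ (x - z)) x := by
  have h0 : ‖x - z‖ ≠ 0 := norm_ne_zero_iff.2 (sub_ne_zero.2 h)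
  have h1 := hasFDerivAt_norm_sub h
  have h2 := ((h1.const_mul b).const_add a).sub ((h1.pow 2).const_mul γ)
  refine h2.congr_fderiv ?_
  ext e
  simp
  field_simp

lemma hessForm_bentCone {z x : Eucl N} (a b γ : ℝ) (h : x ≠ z) (e : Eucl N) :
    hessForm (bentCone z a b γ) x e =
      (b / ‖x - z‖ - 2 * γ) * ‖e‖ ^ 2 - b / ‖x - z‖ ^ 3 * inner ℝ (x - z) e ^ 2 := by
  have h0 : ‖x - z‖ ≠ 0 := norm_ne_zero_iff.2 (sub_ne_zero.2 h)
  have hev : fderiv ℝ (bentCone z a b γ) =ᶠ[𝓝 x]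
      fun y => (b * ‖y - z‖⁻¹ - 2 * γ) • innerSL ℝ (y - z) := by
    filter_upwards [isOpen_ne.mem_nhds h] with y hy
    rw [(hasFDerivAt_bentCone a b γ hy).fderiv, div_eq_mul_inv]
  have hn : HasFDerivAt (fun y : Eucl N => ‖y - z‖⁻¹) _ x :=
    (hasDerivAt_inv h0).comp_hasFDerivAt x (hasFDerivAt_norm_sub h)
  have hc := (hn.const_mul b).sub_const (2 * γ)
  have hw : HasFDerivAt (fun y : Eucl N => innerSL ℝ (y - z))
      (innerSL ℝ : Eucl N →L[ℝ] Eucl N →L[ℝ] ℝ) x :=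
    (innerSL ℝ : Eucl N →L[ℝ] Eucl N →L[ℝ] ℝ).hasFDerivAt.comp x ((hasFDerivAt_id x).sub_const z)
  have hd : HasFDerivAt
      (fun y : Eucl N => (b * ‖y - z‖⁻¹ - 2 * γ) • innerSL ℝ (y - z)) _ x := hc.smul hw
  rw [hessForm, hev.fderiv_eq, hd.fderiv]
  have hi : (innerSL ℝ : Eucl N →L[ℝ] Eucl N →L[ℝ] ℝ) e e = ‖e‖ ^ 2 :=
    real_inner_self_eq_norm_sq e
  simp only [add_apply, smul_apply, ContinuousLinearMap.smulRight_apply, innerSL_apply_apply,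
    smul_eq_mul, hi]
  field_simp
  ring

lemma upperInfLaplacian_bentCone {z x : Eucl N} (a : ℝ) {b γ : ℝ} (h : x ≠ z)
    (hb : 2 * γ * ‖x - z‖ < b) : upperInfLaplacian (bentCone z a b γ) x = -2 * γ := by
  have h0 : 0 < ‖x - z‖ := norm_pos_iff.2 (sub_ne_zero.2 h)
  have hc : 0 < b / ‖x - z‖ - 2 * γ := by
    rw [sub_pos, lt_div_iff₀ h0]; exact hb
  have hg : gradient (bentCone z a b γ) x = (b / ‖x - z‖ - 2 * γ) • (x - z) := by
    rw [gradient, (hasFDerivAt_bentCone a b γ h).fderiv, map_smul]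
    congr 1
    exact (InnerProductSpace.toDual ℝ (Eucl N)).symm_apply_apply _
  obtain ⟨c, hcdef⟩ : ∃ c, c = b / ‖x - z‖ - 2 * γ := ⟨_, rfl⟩
  have hbc : b = (c + 2 * γ) * ‖x - z‖ := by rw [hcdef]; field_simp; ring
  rw [← hcdef] at hc hg
  rw [upperInfLaplacian, hg, if_neg (smul_ne_zero hc.ne' (sub_ne_zero.2 h)), hessForm_bentCone _ _ _ h,
    ← hcdef, norm_smul, inner_smul_right, real_inner_self_eq_norm_sq, Real.norm_eq_abs,
    abs_of_pos hc, hbc]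
  field_simp
  ring

/-- Comparison with cones from above. If `u` lies below a cone of nonnegative slope on `K \ O`, then
it does so on `K`: otherwise `u` minus a slightly bent cone has a local maximum in `O`, where the
bent cone is strictly infinity superharmonic. -/
theorem InfSubharmonicOn.le_cone {u : Eucl N → ℝ} {Ω K O : Set (Eucl N)}
    (hu : InfSubharmonicOn u Ω) (hK : IsCompact K) (huK : UpperSemicontinuousOn u K)
    (hO : IsOpen O) (hOK : O ⊆ K) (hOΩ : O ⊆ Ω) {z : Eucl N} (hz : z ∉ O) {a b : ℝ} (hb : 0 ≤ b)
    (hle : ∀ y ∈ K, y ∉ O → u y ≤ a + b * ‖y - z‖) : ∀ y ∈ K, u y ≤ a + b * ‖y - z‖ := by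
  obtain ⟨R, hR0, hR⟩ : ∃ R > 0, ∀ y ∈ K, ‖y - z‖ ≤ R := by
    obtain ⟨R, hR⟩ := hK.isBounded.subset_closedBall z
    refine ⟨max R 1, by positivity, fun y hy => ?_⟩
    have := hR hy
    rw [mem_closedBall_iff_norm] at this
    exact this.trans (le_max_left _ _)
  -- `η` raises the cone, makes its slope positive and bends it
  have key : ∀ η > 0, ∀ y ∈ K, u y ≤ bentCone z (a + η * R ^ 2) (b + 3 * η * R) η y := by
    intro η hη
    by_contra! hcon
    obtain ⟨y, hyK, hy⟩ := hcon
    have hcont : Continuous (bentCone z (a + η * R ^ 2) (b + 3 * η * R) η) := by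
      unfold bentCone; fun_prop
    have husc : UpperSemicontinuousOn
        (fun y => u y + -bentCone z (a + η * R ^ 2) (b + 3 * η * R) η y) K :=
      huK.add ((Continuous.upperSemicontinuous (f := fun y =>
        -bentCone z (a + η * R ^ 2) (b + 3 * η * R) η y) hcont.neg) |>.upperSemicontinuousOn K)
    obtain ⟨x, hxK, hx⟩ := husc.exists_isMaxOn ⟨y, hyK⟩ hK
    have hxy : u y + -bentCone z (a + η * R ^ 2) (b + 3 * η * R) η y ≤
        u x + -bentCone z (a + η * R ^ 2) (b + 3 * η * R) η x := hx hyK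
    have hxO : x ∈ O := by
      by_contra hxO
      have h1 := hle x hxK hxO
      have h2 := hR x hxK
      have h3 : ‖x - z‖ ^ 2 ≤ R ^ 2 := by gcongr
      have h4 : 0 ≤ 3 * η * R * ‖x - z‖ := by positivity
      have h5 := mul_le_mul_of_nonneg_left h3 hη.le
      have h6 : a + b * ‖x - z‖ ≤ bentCone z (a + η * R ^ 2) (b + 3 * η * R) η x := by
        unfold bentCone; linarith
      linarith
    have hxz : x ≠ z := fun h => hz (h ▸ hxO)
    have hmax : IsLocalMax (fun y => u y - bentCone z (a + η * R ^ 2) (b + 3 * η * R) η y) x := by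
      filter_upwards [hO.mem_nhds hxO] with w hw
      have : u w + -bentCone z (a + η * R ^ 2) (b + 3 * η * R) η w ≤
        u x + -bentCone z (a + η * R ^ 2) (b + 3 * η * R) η x := hx (hOK hw)
      linarith
    have h0 := hu.2 x (hOΩ hxO) _ (contDiffAt_bentCone _ _ _ hxz) hmax
    have h1 := mul_le_mul_of_nonneg_left (hR x hxK) hη.le
    rw [upperInfLaplacian_bentCone _ hxz (by nlinarith [mul_pos hη hR0])] at h0
    linarith
  intro y hy
  have hlim : Tendsto (fun η : ℝ => bentCone z (a + η * R ^ 2) (b + 3 * η * R) η y) (𝓝[>] 0)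
      (𝓝 (a + b * ‖y - z‖)) := by
    have hc : Continuous fun η : ℝ => bentCone z (a + η * R ^ 2) (b + 3 * η * R) η y := by
      unfold bentCone; fun_prop
    have := (hc.tendsto 0).mono_left (nhdsWithin_le_nhds (s := Ioi 0))
    simpa [bentCone] using this
  exact ge_of_tendsto hlim (eventually_nhdsWithin_of_forall fun η hη => key η hη y hy)

end Barrier

/-! ### Distance to the boundary and growth -/

section Geometry

variable {N : ℕ} {Ω : Set (Eucl N)}

lemma exists_mem_frontier_of_not_subset (hΩ : IsOpen Ω) {s : Set (Eucl N)} (hs : IsPreconnected s)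
    (hne : (s ∩ Ω).Nonempty) (h : ¬ s ⊆ Ω) : ∃ z ∈ s, z ∈ frontier Ω := by
  by_contra! hcon
  refine h (hs.subset_of_closure_inter_subset hΩ hne fun y hy => ?_)
  by_contra hyΩ
  exact hcon y hy.2 (hΩ.frontier_eq ▸ ⟨hy.1, hyΩ⟩)

lemma ball_infDist_frontier_subset (hΩ : IsOpen Ω) {x : Eucl N} (hx : x ∈ Ω) :
    Metric.ball x (Metric.infDist x (frontier Ω)) ⊆ Ω := by
  by_contra h
  have hpos : 0 < Metric.infDist x (frontier Ω) := by
    by_contra! h0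
    exact h (by simp [Metric.ball_eq_empty.2 h0])
  obtain ⟨z, hz, hzf⟩ := exists_mem_frontier_of_not_subset hΩ
    (convex_ball x _).isPreconnected ⟨x, Metric.mem_ball_self hpos, hx⟩ h
  have := Metric.infDist_le_dist_of_mem (x := x) hzf
  rw [Metric.mem_ball, dist_comm] at hz
  linarith

lemma closedBall_infDist_frontier_subset (hΩ : IsOpen Ω) {x : Eucl N} (hx : x ∈ closure Ω) :
    Metric.closedBall x (Metric.infDist x (frontier Ω)) ⊆ closure Ω := by
  by_cases h0 : Metric.infDist x (frontier Ω) = 0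
  · rw [h0, Metric.closedBall_zero]
    exact singleton_subset_iff.2 hx
  · rw [← closure_ball x h0]
    refine closure_mono (ball_infDist_frontier_subset hΩ ?_)
    by_contra hxΩ
    exact h0 (Metric.infDist_zero_of_mem (hΩ.frontier_eq ▸ ⟨hx, hxΩ⟩))

lemma intrinsicEDist_le_of_segment_subset {K : Set (Eucl N)} {x y : Eucl N}
    (h : segment ℝ x y ⊆ K) : intrinsicEDist K x y ≤ edist x y := by
  refine iInf₂_le_of_le (Path.segment x y) (fun t => h ?_) ?_
  · rw [segment_eq_image_lineMap]
    exact ⟨t, t.2, rfl⟩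
  · have hlip : LipschitzOnWith (nndist x y) (fun t : ℝ => AffineMap.lineMap x y t) univ :=
      (lipschitzWith_lineMap x y).lipschitzOnWith
    have h1 := hlip.comp_eVariationOn_le (g := fun t : unitInterval => (t : ℝ))
      (mapsTo_univ _ (univ : Set unitInterval))
    have h2 : eVariationOn (fun t : unitInterval => (t : ℝ)) univ = 1 := by
      have hmono : MonotoneOn (fun t : unitInterval => (t : ℝ)) univ :=
        fun s _ t _ hst => hst
      have := hmono.eVariationOn_eq (mem_univ 0) (mem_univ 1)
      have hIcc : (univ : Set unitInterval) ∩ Icc 0 1 = univ := by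
        ext t; simp [unitInterval.le_one']
      rw [hIcc] at this
      simpa using this
    rw [h2, mul_one] at h1
    rw [edist_nndist]
    exact h1

/-- Since the segment from `y` to a nearest boundary point stays in `closure Ω`, the intrinsic
distance to the boundary is at most the Euclidean one. -/
lemma mem_boundaryLayer_of_dist_le (hΩ : IsOpen Ω) {y z : Eucl N} (hy : y ∈ closure Ω)
    (hz : z ∈ frontier Ω) {r : ℝ} (hr : dist y z ≤ r) : y ∈ boundaryLayer Ω r := by
  refine ⟨hy, ?_⟩
  obtain ⟨p, hp, hd⟩ := isClosed_frontier.exists_infDist_eq_dist ⟨z, hz⟩ y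
  refine iInf₂_le_of_le p hp ((intrinsicEDist_le_of_segment_subset ?_).trans ?_)
  · refine Subset.trans ?_ (closedBall_infDist_frontier_subset hΩ hy)
    refine (convex_closedBall y _).segment_subset
      (Metric.mem_closedBall_self Metric.infDist_nonneg) ?_
    rw [Metric.mem_closedBall, dist_comm, hd]
  · rw [edist_dist]
    exact ENNReal.ofReal_le_ofReal
      ((hd ▸ Metric.infDist_le_dist_of_mem hz).trans hr)

/-- A quantitative form of the growth condition: at most linear growth of arbitrarily small slope in
the distance from the boundary. -/
def SublinearAbove (u : Eucl N → ℝ) (Ω : Set (Eucl N)) : Prop :=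
  ∀ σ > 0, ∃ C, ∀ y ∈ closure Ω, ∀ z ∈ frontier Ω, u y ≤ C + σ * ‖y - z‖

lemma sublinearAbove_of_eventually (hΩ : IsOpen Ω) {u : Eucl N → ℝ}
    (h : ∀ σ > 0, ∀ᶠ r : ℝ in atTop, ∀ y ∈ boundaryLayer Ω r, u y ≤ σ * r) :
    SublinearAbove u Ω := by
  intro σ hσ
  obtain ⟨R, hR⟩ := eventually_atTop.1 (h σ hσ)
  refine ⟨σ * |R|, fun y hy z hz => ?_⟩
  have h1 := hR (|R| + ‖y - z‖) (by linarith [le_abs_self R, norm_nonneg (y - z)]) y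
    (mem_boundaryLayer_of_dist_le hΩ hy hz (by rw [dist_eq_norm]; linarith [abs_nonneg R]))
  linarith

lemma sublinearAbove_of_limsup_le (hΩ : IsOpen Ω) {u : Eucl N → ℝ}
    (h : limsup (fun r : ℝ => (⨆ y ∈ boundaryLayer Ω r, (u y : EReal)) / (r : EReal)) atTop ≤ 0) :
    SublinearAbove u Ω := by
  refine sublinearAbove_of_eventually hΩ fun σ hσ => ?_
  have hlt := h.trans_lt (EReal.coe_pos.2 hσ)
  filter_upwards [eventually_lt_of_limsup_lt hlt, eventually_gt_atTop 0] with r hr hr0 y hy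
  rw [mul_comm]
  have h1 := (EReal.div_le_iff_le_mul (EReal.coe_pos.2 hr0) (EReal.coe_ne_top r)).1 hr.le
  exact_mod_cast (le_iSup₂ (f := fun y (_ : y ∈ boundaryLayer Ω r) => (u y : EReal)) y hy).trans h1

lemma sublinearAbove_neg_of_le_liminf (hΩ : IsOpen Ω) {v : Eucl N → ℝ}
    (h : 0 ≤ liminf (fun r : ℝ => (⨅ y ∈ boundaryLayer Ω r, (v y : EReal)) / (r : EReal)) atTop) :
    SublinearAbove (fun x => -v x) Ω := by
  refine sublinearAbove_of_eventually hΩ fun σ hσ => ?_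
  have hlt := lt_of_lt_of_le (show ((-σ : ℝ) : EReal) < 0 from by exact_mod_cast neg_lt_zero.2 hσ) h
  filter_upwards [eventually_lt_of_lt_liminf hlt, eventually_gt_atTop 0] with r hr hr0 y hy
  have h1 := (EReal.le_div_iff_mul_le (EReal.coe_pos.2 hr0) (EReal.coe_ne_top r)).1 hr.le
  have h2 := h1.trans (iInf₂_le (f := fun y (_ : y ∈ boundaryLayer Ω r) => (v y : EReal)) y hy)
  have h3 : -σ * r ≤ v y := by exact_mod_cast h2
  linarith

end Geometry

/-! ### Estimates up to the boundary -/

section BoundaryEstimate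

variable {N : ℕ} {Ω : Set (Eucl N)} {u : Eucl N → ℝ}

/-- Comparison on the unbounded set `Ω` with a cone whose vertex is a boundary point: by sublinear
growth `u` lies below the cone on large spheres. -/
lemma InfSubharmonicOn.le_cone_of_frontier (hΩ : IsOpen Ω) (hsub : InfSubharmonicOn u Ω)
    (husc : UpperSemicontinuousOn u (closure Ω)) (hgrowth : SublinearAbove u Ω) {z : Eucl N}
    (hz : z ∈ frontier Ω) {a b : ℝ} (hb : 0 < b)
    (hle : ∀ y ∈ frontier Ω, u y ≤ a + b * ‖y - z‖) :
    ∀ x ∈ closure Ω, u x ≤ a + b * ‖x - z‖ := by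
  intro x hx
  obtain ⟨C, hC⟩ := hgrowth (b / 2) (by positivity)
  obtain ⟨R, hR⟩ : ∃ R, R = max ‖x - z‖ (2 * (C - a) / b) := ⟨_, rfl⟩
  have hR1 : ‖x - z‖ ≤ R := hR ▸ le_max_left _ _
  have hR2 : 2 * (C - a) ≤ R * b := by
    rw [← div_le_iff₀ hb]; exact hR ▸ le_max_right _ _
  rw [hΩ.frontier_eq] at hz
  refine hsub.le_cone (K := closure Ω ∩ Metric.closedBall z R) (O := Ω ∩ Metric.ball z R)
    ((isCompact_closedBall z R).inter_left isClosed_closure)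
    (husc.mono inter_subset_left) (hΩ.inter Metric.isOpen_ball)
    (inter_subset_inter subset_closure Metric.ball_subset_closedBall) inter_subset_left
    (fun h => hz.2 h.1) hb.le ?_ x ⟨hx, by rwa [mem_closedBall_iff_norm]⟩
  rintro y ⟨hy, hyR⟩ hyO
  by_cases hyΩ : y ∈ Ω
  · have h1 : R ≤ ‖y - z‖ := by
      by_contra! h
      exact hyO ⟨hyΩ, mem_ball_iff_norm.2 h⟩
    have h2 := hC y hy z (hΩ.frontier_eq ▸ hz)
    have h3 := mul_le_mul_of_nonneg_left h1 hb.le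
    linarith
  · exact hle y (hΩ.frontier_eq ▸ ⟨hy, hyΩ⟩)

lemma exists_linear_modulus {S : Set (Eucl N)} (hunif : UniformContinuousOn u S)
    (hbdd : Bornology.IsBounded (u '' S)) {η : ℝ} (hη : 0 < η) :
    ∃ L > 0, ∀ w ∈ S, ∀ z ∈ S, u w ≤ u z + η + L * ‖w - z‖ := by
  obtain ⟨G, hG⟩ := hbdd.exists_norm_le
  obtain ⟨δ, hδ, h⟩ := Metric.uniformContinuousOn_iff.1 hunif η hη
  refine ⟨(2 * |G| + 1) / δ, by positivity, fun w hw z hz => ?_⟩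
  by_cases hd : dist w z < δ
  · have h1 := (abs_lt.1 (Real.dist_eq _ _ ▸ h w hw z hz hd)).2
    have : 0 ≤ (2 * |G| + 1) / δ * ‖w - z‖ := by positivity
    linarith
  · have h1 := (abs_le.1 (Real.norm_eq_abs _ ▸ hG _ (mem_image_of_mem u hw))).2
    have h2 := (abs_le.1 (Real.norm_eq_abs _ ▸ hG _ (mem_image_of_mem u hz))).1
    have h3 : δ ≤ ‖w - z‖ := by rw [← dist_eq_norm]; exact not_lt.1 hd
    have h4 : 2 * |G| + 1 ≤ (2 * |G| + 1) / δ * ‖w - z‖ := by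
      rw [div_mul_eq_mul_div, le_div_iff₀ hδ]; gcongr
    linarith [le_abs_self G]

/-- The boundary values are attained with a modulus of continuity that is uniform along the possibly
unbounded boundary. -/
lemma InfSubharmonicOn.exists_boundary_modulus (hΩ : IsOpen Ω) (hsub : InfSubharmonicOn u Ω)
    (husc : UpperSemicontinuousOn u (closure Ω)) (hgrowth : SublinearAbove u Ω)
    (hunif : UniformContinuousOn u (frontier Ω)) (hbdd : Bornology.IsBounded (u '' frontier Ω))
    {η : ℝ} (hη : 0 < η) :
    ∃ L > 0, ∀ x ∈ closure Ω, ∀ z ∈ frontier Ω, u x ≤ u z + η + L * ‖x - z‖ := by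
  obtain ⟨L, hL, h⟩ := exists_linear_modulus hunif hbdd hη
  exact ⟨L, hL, fun x hx z hz =>
    hsub.le_cone_of_frontier hΩ husc hgrowth hz hL (fun y hy => h y hy z hz) x hx⟩

lemma InfSubharmonicOn.exists_upper_bound (hΩ : IsOpen Ω) (hne : (frontier Ω).Nonempty)
    (hsub : InfSubharmonicOn u Ω) (husc : UpperSemicontinuousOn u (closure Ω))
    (hgrowth : SublinearAbove u Ω) (hbdd : Bornology.IsBounded (u '' frontier Ω)) :
    ∃ A, ∀ x ∈ closure Ω, u x ≤ A := by
  obtain ⟨G, hG⟩ := hbdd.exists_norm_le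
  obtain ⟨z, hz⟩ := hne
  refine ⟨G, fun x hx => ?_⟩
  have key : ∀ b > 0, u x ≤ G + b * ‖x - z‖ := fun b hb =>
    hsub.le_cone_of_frontier hΩ husc hgrowth hz hb (fun y hy => by
      have h1 := (le_abs_self (u y)).trans (hG _ (mem_image_of_mem u hy))
      have : 0 ≤ b * ‖y - z‖ := by positivity
      linarith) x hx
  have hlim : Tendsto (fun b : ℝ => G + b * ‖x - z‖) (𝓝[>] 0) (𝓝 G) := by
    have hc : Continuous fun b : ℝ => G + b * ‖x - z‖ := by fun_prop
    have := (hc.tendsto 0).mono_left (nhdsWithin_le_nhds (s := Ioi 0))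
    simpa using this
  exact ge_of_tendsto hlim (eventually_nhdsWithin_of_forall key)

end BoundaryEstimate

/-! ### Maxima over small balls -/

section Discretization

variable {N : ℕ} {Ω : Set (Eucl N)} {u : Eucl N → ℝ}

/-- The supremum of `u` over the closed ball of radius `ε` around `x`. -/
noncomputable def ballSup (u : Eucl N → ℝ) (ε : ℝ) (x : Eucl N) : ℝ :=
  sSup (u '' Metric.closedBall x ε)

lemma exists_ballSup_eq {x : Eucl N} {ε : ℝ} (hε : 0 ≤ ε)
    (hu : UpperSemicontinuousOn u (Metric.closedBall x ε)) :
    ∃ y ∈ Metric.closedBall x ε, ballSup u ε x = u y ∧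
      ∀ w ∈ Metric.closedBall x ε, u w ≤ ballSup u ε x := by
  obtain ⟨y, hy, hmax⟩ := hu.exists_isMaxOn ⟨x, Metric.mem_closedBall_self hε⟩
    (isCompact_closedBall x ε)
  have heq : ballSup u ε x = u y :=
    IsGreatest.csSup_eq ⟨mem_image_of_mem u hy, by rintro _ ⟨w, hw, rfl⟩; exact hmax hw⟩
  exact ⟨y, hy, heq, fun w hw => heq ▸ hmax hw⟩

/-- The maximum of an infinity subharmonic function over `ε`-balls satisfies the discrete inequality
at scale `ε`: comparison with a cone bounds the maximum over the `ε`-ball by the mean of the value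
at the centre and the maximum over the `2ε`-ball. -/
lemma InfSubharmonicOn.discreteInfSubharmonic_ballSup (hsub : InfSubharmonicOn u Ω) {ε : ℝ}
    (hε : 0 < ε) :
    DiscreteInfSubharmonic (fun x y => dist x y ≤ ε) {x | Metric.closedBall x (2 * ε) ⊆ Ω}
      (ballSup u ε) := by
  intro x hx
  have hxΩ : Metric.closedBall x (2 * ε) ⊆ Ω := hx
  have hball : ∀ y, dist x y ≤ ε → Metric.closedBall y ε ⊆ Metric.closedBall x (2 * ε) :=
    fun y hy => Metric.closedBall_subset_closedBall' (by rw [dist_comm]; linarith)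
  have hmax := fun y (hy : dist x y ≤ ε) =>
    exists_ballSup_eq hε.le (hsub.1.mono ((hball y hy).trans hxΩ))
  obtain ⟨q, hq, hqeq, hqmax⟩ := exists_ballSup_eq (by positivity) (hsub.1.mono hxΩ)
  rw [hqeq] at hqmax
  have hxq : u x ≤ u q := hqmax x (Metric.mem_closedBall_self (by positivity))
  have hcone := hsub.le_cone (K := Metric.closedBall x (2 * ε))
    (O := Metric.ball x (2 * ε) ∩ {x}ᶜ) (z := x) (a := u x) (b := (u q - u x) / (2 * ε))
    (isCompact_closedBall _ _) (hsub.1.mono hxΩ) (Metric.isOpen_ball.inter isOpen_compl_singleton)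
    (inter_subset_left.trans Metric.ball_subset_closedBall)
    ((inter_subset_left.trans Metric.ball_subset_closedBall).trans hxΩ) (by simp)
    (div_nonneg (by linarith) (by positivity)) (fun y hy hyO => by
      by_cases hyx : y = x
      · simp [hyx]
      · have h1 : 2 * ε ≤ ‖y - x‖ := by
          by_contra! h
          exact hyO ⟨mem_ball_iff_norm.2 h, hyx⟩
        have h2 : u q - u x ≤ (u q - u x) / (2 * ε) * ‖y - x‖ := by
          rw [div_mul_eq_mul_div, le_div_iff₀ (by positivity)]
          exact mul_le_mul_of_nonneg_left h1 (by linarith)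
        linarith [hqmax y hy])
  -- a maximal neighbour is half way to the maximum point of `u` in the doubled ball
  have hxp : dist x (midpoint ℝ x q) ≤ ε := by
    rw [dist_left_midpoint, Real.norm_eq_abs, abs_of_pos two_pos, dist_comm]
    rw [Metric.mem_closedBall] at hq
    linarith
  have hpq : q ∈ Metric.closedBall (midpoint ℝ x q) ε := by
    rw [Metric.mem_closedBall, dist_right_midpoint, Real.norm_eq_abs, abs_of_pos two_pos, dist_comm]
    rw [Metric.mem_closedBall] at hq
    linarith
  obtain ⟨-, -, -, hp⟩ := hmax _ hxp
  have hp' := hp q hpq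
  refine ⟨midpoint ℝ x q, hxp, fun y hy => ?_⟩
  obtain ⟨w, hw, hweq, hwmax⟩ := hmax y hy
  refine ⟨hweq ▸ (hqmax w (hball y hy hw)).trans hp', ?_⟩
  obtain ⟨w', hw', hweq', -⟩ := hmax x (by simpa using hε.le)
  have h1 := hcone w' (hball x (by simpa using hε.le) hw')
  have h2 : (u q - u x) / (2 * ε) * ‖w' - x‖ ≤ (u q - u x) / 2 := by
    rw [mem_closedBall_iff_norm] at hw'
    calc (u q - u x) / (2 * ε) * ‖w' - x‖ ≤ (u q - u x) / (2 * ε) * ε :=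
          mul_le_mul_of_nonneg_left hw' (div_nonneg (by linarith) (by positivity))
      _ = (u q - u x) / 2 := by field_simp
  have h3 := hwmax x (by rwa [Metric.mem_closedBall])
  linarith

/-- Steps of length `ε` towards the nearest boundary point decrease the integer part of
`dist(x, ∂Ω) / ε`. -/
lemma exists_step_toward_frontier (hne : (frontier Ω).Nonempty) {ε : ℝ} (hε : 0 < ε) {x : Eucl N}
    (hx : ε ≤ Metric.infDist x (frontier Ω)) :
    ∃ y, dist x y ≤ ε ∧ ⌊Metric.infDist y (frontier Ω) / ε⌋₊ <
      ⌊Metric.infDist x (frontier Ω) / ε⌋₊ := by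
  obtain ⟨z, hz, hd⟩ := isClosed_frontier.exists_infDist_eq_dist hne x
  have hd0 : 0 < dist x z := hd ▸ hε.trans_le hx
  rw [hd] at hx ⊢
  have hyx : dist x (AffineMap.lineMap x z (ε / dist x z)) = ε := by
    rw [dist_left_lineMap, Real.norm_eq_abs, abs_of_pos (by positivity)]
    field_simp
  have hyz : dist (AffineMap.lineMap x z (ε / dist x z)) z = dist x z - ε := by
    rw [dist_lineMap_right, Real.norm_eq_abs, abs_of_nonneg]
    · field_simp
    · rw [sub_nonneg, div_le_one hd0]; exact hx
  refine ⟨AffineMap.lineMap x z (ε / dist x z), hyx.le, ?_⟩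
  have h1 := Metric.infDist_le_dist_of_mem (x := AffineMap.lineMap x z (ε / dist x z)) hz
  rw [hyz] at h1
  have h2 : Metric.infDist (AffineMap.lineMap x z (ε / dist x z)) (frontier Ω) / ε ≤
      dist x z / ε - 1 := by
    rw [div_sub_one hε.ne']; gcongr
  have h3 : 1 ≤ dist x z / ε := (one_le_div hε).2 hx
  calc _ ≤ ⌊dist x z / ε - 1⌋₊ := Nat.floor_mono h2
    _ < ⌊dist x z / ε⌋₊ := by
      have h4 : 1 ≤ ⌊dist x z / ε⌋₊ := (Nat.one_le_floor_iff _).2 h3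
      rw [Nat.floor_sub_one]
      omega

end Discretization

/-! ### Comparison on unbounded domains -/

theorem theorem1p6 (N : ℕ) (Ω : Set (Eucl N))
    (hΩo : IsOpen Ω) (hΩc : IsConnected Ω) (hΩu : ¬ Bornology.IsBounded Ω)
    (hΩb : (frontier Ω).Nonempty)
    (u v : Eucl N → ℝ)
    (hu_usc : UpperSemicontinuousOn u (closure Ω))
    (hv_lsc : LowerSemicontinuousOn v (closure Ω))
    (hu_sub : InfSubharmonicOn u Ω)
    (hv_sub : InfSubharmonicOn (fun x => -v x) Ω)
    (hu_unif : UniformContinuousOn u (frontier Ω))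
    (hv_unif : UniformContinuousOn v (frontier Ω))
    (hu_bdd : Bornology.IsBounded (u '' frontier Ω))
    (hv_bdd : Bornology.IsBounded (v '' frontier Ω))
    (hu_growth :
      limsup (fun r : ℝ => (⨆ y ∈ boundaryLayer Ω r, (u y : EReal)) / (r : EReal)) atTop ≤ 0)
    (hv_growth :
      0 ≤ liminf (fun r : ℝ => (⨅ y ∈ boundaryLayer Ω r, (v y : EReal)) / (r : EReal)) atTop) :
    ∀ x ∈ Ω, u x - v x ≤ sSup ((fun y => u y - v y) '' frontier Ω) := by
  have hug := sublinearAbove_of_limsup_le hΩo hu_growth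
  have hvg := sublinearAbove_neg_of_le_liminf hΩo hv_growth
  have hw_usc : UpperSemicontinuousOn (fun x => -v x) (closure Ω) := by
    intro x hx y hy
    filter_upwards [hv_lsc x hx (-y) (by linarith)] with w hw
    linarith
  have hw_unif : UniformContinuousOn (fun x => -v x) (frontier Ω) :=
    uniformContinuous_neg.comp_uniformContinuousOn hv_unif
  have hw_bdd : Bornology.IsBounded ((fun x => -v x) '' frontier Ω) := by
    obtain ⟨G, hG⟩ := hv_bdd.exists_norm_le
    refine isBounded_iff_forall_norm_le.2 ⟨G, ?_⟩
    rintro _ ⟨y, hy, rfl⟩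
    simpa using hG _ (mem_image_of_mem v hy)
  have hle : ∀ z ∈ frontier Ω, u z - v z ≤ sSup ((fun y => u y - v y) '' frontier Ω) := by
    intro z hz
    refine le_csSup ?_ (mem_image_of_mem (fun y => u y - v y) hz)
    obtain ⟨G, hG⟩ := hu_bdd.exists_norm_le
    obtain ⟨H, hH⟩ := hw_bdd.exists_norm_le
    refine ⟨G + H, ?_⟩
    rintro _ ⟨y, hy, rfl⟩
    have h1 := (le_abs_self _).trans (hG _ (mem_image_of_mem u hy))
    have h2 := (le_abs_self _).trans (hH _ (mem_image_of_mem (fun x => -v x) hy))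
    simp only at h2 ⊢
    linarith
  obtain ⟨A, hA⟩ := hu_sub.exists_upper_bound hΩo hΩb hu_usc hug hu_bdd
  obtain ⟨B, hB⟩ := hv_sub.exists_upper_bound hΩo hΩb hw_usc hvg hw_bdd
  intro x hx
  refine le_of_forall_pos_le_add fun η hη => ?_
  obtain ⟨L₁, hL₁, h₁⟩ := hu_sub.exists_boundary_modulus hΩo hu_usc hug hu_unif hu_bdd
    (show 0 < η / 4 by positivity)
  obtain ⟨L₂, hL₂, h₂⟩ := hv_sub.exists_boundary_modulus hΩo hw_usc hvg hw_unif hw_bdd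
    (show 0 < η / 4 by positivity)
  obtain ⟨ρ, hρ, hρΩ⟩ := Metric.nhds_basis_closedBall.mem_iff.1 (hΩo.mem_nhds hx)
  obtain ⟨ε, hε⟩ : ∃ ε, ε = min ρ (η / (6 * (L₁ + L₂))) := ⟨_, rfl⟩
  have hε0 : 0 < ε := hε ▸ lt_min hρ (by positivity)
  have hερ : ε ≤ ρ := hε ▸ min_le_left _ _
  have hεη : ε * (6 * (L₁ + L₂)) ≤ η := by
    rw [← le_div_iff₀ (by positivity)]; exact hε ▸ min_le_right _ _
  -- near the boundary the comparison holds up to `η`, by the uniform boundary moduli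
  have hlayer : ∀ y, Metric.closedBall y ε ⊆ Ω → ¬ Metric.closedBall y (2 * ε) ⊆ Ω →
      ballSup u ε y + ballSup (fun x => -v x) ε y ≤
        sSup ((fun y => u y - v y) '' frontier Ω) + η := by
    intro y hy hy2
    obtain ⟨z, hzy, hz⟩ := exists_mem_frontier_of_not_subset hΩo
      (convex_closedBall y (2 * ε)).isPreconnected
      ⟨y, Metric.mem_closedBall_self (by positivity), hy (Metric.mem_closedBall_self hε0.le)⟩ hy2
    have hnear : ∀ w ∈ Metric.closedBall y ε, ‖w - z‖ ≤ 3 * ε := by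
      intro w hw
      rw [Metric.mem_closedBall] at hw hzy
      rw [← dist_eq_norm]
      linarith [dist_triangle_right w z y]
    obtain ⟨p, hp, hpeq, -⟩ := exists_ballSup_eq hε0.le (hu_sub.1.mono hy)
    obtain ⟨q, hq, hqeq, -⟩ := exists_ballSup_eq hε0.le (hv_sub.1.mono hy)
    rw [hpeq, hqeq]
    have h3 := h₁ p (subset_closure (hy hp)) z hz
    have h4 := h₂ q (subset_closure (hy hq)) z hz
    have h5 := mul_le_mul_of_nonneg_left (hnear p hp) hL₁.le
    have h6 := mul_le_mul_of_nonneg_left (hnear q hq) hL₂.le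
    have h7 := hle z hz
    linarith
  have hxX : Metric.closedBall x ε ⊆ Ω := (Metric.closedBall_subset_closedBall hερ).trans hρΩ
  have hcomp := DiscreteInfSubharmonic.add_le (r := fun x y => dist x y ≤ ε)
    (I := {x | Metric.closedBall x (2 * ε) ⊆ Ω}) (X := {x | Metric.closedBall x ε ⊆ Ω})
    (fun x y h => by rwa [dist_comm])
    (fun y hy => (Metric.closedBall_subset_closedBall (by linarith)).trans hy)
    (fun y hy w hw => (Metric.closedBall_subset_closedBall'
      (by rw [dist_comm]; linarith)).trans hy)
    (hu_sub.discreteInfSubharmonic_ballSup hε0) (hv_sub.discreteInfSubharmonic_ballSup hε0)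
    (A := A) (B := B)
    (fun y hy => by
      obtain ⟨p, hp, hpeq, -⟩ := exists_ballSup_eq hε0.le (hu_sub.1.mono hy)
      exact hpeq ▸ hA p (subset_closure (hy hp)))
    (fun y hy => by
      obtain ⟨p, hp, hpeq, -⟩ := exists_ballSup_eq hε0.le (hv_sub.1.mono hy)
      exact hpeq ▸ hB p (subset_closure (hy hp)))
    (fun y hy hyI => hlayer y hy hyI)
    (fun y => ⌊Metric.infDist y (frontier Ω) / ε⌋₊)
    (fun y hy => exists_step_toward_frontier hΩb hε0 (by
      obtain ⟨z, hz, hd⟩ := isClosed_frontier.exists_infDist_eq_dist hΩb y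
      rw [hd]
      by_contra! hlt
      rw [hΩo.frontier_eq] at hz
      exact hz.2 (hy (by rw [Metric.mem_closedBall, dist_comm]; linarith)))) x hxX
  obtain ⟨-, -, -, hp⟩ := exists_ballSup_eq hε0.le (hu_sub.1.mono hxX)
  obtain ⟨-, -, -, hq⟩ := exists_ballSup_eq hε0.le (hv_sub.1.mono hxX)
  have h3 := hp x (Metric.mem_closedBall_self hε0.le)
  have h4 := hq x (Metric.mem_closedBall_self hε0.le)
  linarith
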